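/- **Theorem (compactness for piecewise constant functions with values in moving Hilbert spaces).** Let $V,H$ be real Hilbert spaces with $V$ compactly embedded in $H$, and let $T>0$. Consider a family of time steps $\Delta t$ (for instance a sequence), each of the form $\Delta t=T/N$ with an integer $N=N_{\Delta t}\ge 1$. For each $\Delta t$ of the family let $V^n_{\Delta t}$ ($1\le n\le N$) and $Q^n_{\Delta t}$ ($0\le n\le N$) be Hilbert spaces that are continuously and injectively embedded in $V$, with embedding constants independent of $\Delta t$ and $n$, and let $V^n_{\Delta t}\subset\overline{Q^n_{\Delta t}}^{H}$ for $1\le n\le N$ (this inclusion is then automatically compact, because $V$ is compactly embedded in $H$). Elements of these spaces are identified with their images in $V$ and in $H$. For a normed space $Q$ embedded in $H$ and $w\in H$ write $\|w\|_{Q'}=\sup\{|(w,q)_H| : q\in Q,\ \|q\|_Q\le 1\}$. Let $u^0_{\Delta t}\in H$ and $u^n_{\Delta t}\in V^n_{\Delta t}$, $n=1,\dots,N$, and let $u_{\Delta t}\in L^2(0,T;H)$ be given by $u_{\Delta t}(t)=u^n_{\Delta t}$ for $t\in((n-1)\Delta t,n\Delta t]$, $n=1,\dots,N$. Write $(\tau_h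 f)(t)=f(t-h)$. Suppose that the following hold, with constants $C>0$ that do not depend on $\Delta t,n,l,i,j$. * **(A)** For every $\Delta t$: (A1) $\sum_{n=1}^N\|u^n_{\Delta t}\|_{V^n_{\Delta t}}^2\,\Delta t\le C$; (A2) $\|u_{\Delta t}\|_{L^\infty(0,T;H)}\le C$; (A3) $\|\tau_{\Delta t}u_{\Delta t}-u_{\Delta t}\|^2_{L^2(\Delta t,T;H)}\le C\,\Delta t$. * **(B)** For every $\Delta t$ and $n=0,\dots,N-1$, $$\Big\|P^n_{\Delta t}\frac{u^{n+1}_{\Delta t}-u^n_{\Delta t}}{\Delta t}\Big\|_{(Q^n_{\Delta t})'}\le C\big(\|u^{n+1}_{\Delta t}\|_{V^{n+1}_{\Delta t}}+1\big),$$ where $P^n_{\Delta t}$ is the orthogonal projector of $H$ onto $\overline{Q^n_{\Delta t}}^{H}$. * **(C1)** For all $\Delta t$, $l\in\{1,\dots,N\}$ and $n\in\{1,\dots,N-l\}$ there are a normed space $Q^{n,l}_{\Delta t}$, contained in $V$ as a linear subspace, and maps $J^i=J^i_{\Delta t,l,n}:Q^{n,l}_{\Delta t}\to Q^{n+i}_{\Delta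 t}$, $i=0,\dots,l$, such that for all $q\in Q^{n,l}_{\Delta t}$ $$\|J^iq\|_{Q^{n+i}_{\Delta t}}\le C\|q\|_{Q^{n,l}_{\Delta t}},\qquad \|J^iq-q\|_H\le C\sqrt{l\Delta t}\,\|q\|_{Q^{n,l}_{\Delta t}},\qquad 0\le i\le l,$$ $$\big(J^{j+1}q-J^jq,\;u^{n+j+1}_{\Delta t}\big)_H\le C\,\Delta t\,\|q\|_{Q^{n,l}_{\Delta t}}\|u^{n+j+1}_{\Delta t}\|_{V^{n+j+1}_{\Delta t}},\qquad 0\le j\le l-1.$$ * **(C2)** Let $V^{n,l}_{\Delta t}$ be the closure of $Q^{n,l}_{\Delta t}$ in $V$, with the norm of $V$. For all $\Delta t,l,n$ as in (C1) there are maps $I^i=I^i_{\Delta t,l,n}:V^{n+i}_{\Delta t}\to V^{n,l}_{\Delta t}$, $i=0,\dots,l$, such that for all $v\in V^{n+i}_{\Delta t}$ $$\|I^iv\|_{V^{n,l}_{\Delta t}}\le C\|v\|_{V^{n+i}_{\Delta t}},\qquad \|I^iv-v\|_H\le g(l\Delta t)\,\|v\|_{V^{n+i}_{\Delta t}},$$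 where $g:(0,\infty)\to[0,\infty)$ is a nondecreasing function, the same for all $\Delta t,n,l,i$, with $g(h)\to0$ as $h\to0^+$. * **(C3)** (uniform Ehrling property) For every $\delta>0$ there is a constant $C(\delta)>0$, independent of $\Delta t,n,l$, such that for all $\Delta t,l,n$ as in (C1) $$\|v\|_H\le\delta\|v\|_{V^{n,l}_{\Delta t}}+C(\delta)\|v\|_{(Q^{n,l}_{\Delta t})'}\qquad\text{for all }v\in V^{n,l}_{\Delta t}.$$ Then $\{u_{\Delta t}\}$ is relatively compact in $L^2(0,T;H)$. -/

import Mathlib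

open MeasureTheory Set Filter Topology
open scoped ENNReal

namespace MovingSpaces

/-- The closure in `X` of the image of `Q` under a linear embedding `e : Q → X`. -/
def closureIn {Q X : Type*} [AddCommGroup Q] [Module ℝ Q] [NormedAddCommGroup X]
    [NormedSpace ℝ X] (e : Q →ₗ[ℝ] X) : Submodule ℝ X :=
  (LinearMap.range e).topologicalClosure

/-- The orthogonal projector of the Hilbert space `H` onto the closure of `Q` in `H`. -/
noncomputable def proj {Q H : Type*} [AddCommGroup Q] [Module ℝ Q] [NormedAddCommGroup H]
    [InnerProductSpace ℝ H] [CompleteSpace H] (e : Q →ₗ[ℝ] H) : H →L[ℝ] H :=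
  haveI : CompleteSpace (closureIn e) :=
    (Submodule.isClosed_topologicalClosure (LinearMap.range e)).completeSpace_coe
  (closureIn e).starProjection

/-- The norm in the dual `Q'` of the functional `q ↦ (w, q)_H` given by `w ∈ H`, where `Q` is
embedded in `H` by `e`: the supremum of `|(w, q)_H|` over the closed unit ball of `Q`, with the
value `∞` if the functional is unbounded. -/
noncomputable def dualNorm {Q H : Type*} [NormedAddCommGroup Q] [NormedSpace ℝ Q]
    [NormedAddCommGroup H] [InnerProductSpace ℝ H] (e : Q →ₗ[ℝ] H) (w : H) : ℝ≥0∞ :=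
  ⨆ q : {q : Q // ‖q‖ ≤ 1}, ENNReal.ofReal |inner ℝ w (e q)|

end MovingSpaces

/-!
Relative compactness in `L²(0,T;H)` is obtained in two steps.

*Translates.* The increment `u^{n+l} - u^n`, tested with `q ∈ Q^{n,l}`, is expanded by summation by
parts along the elements `J^j q`: the increments of `u` are paired with `J^j q ∈ Q^{n+j}`, where the
evolution bound (B) applies (the projector is invisible against `Q^{n+j}`), and the increments of
`J^j q` are paired with `u`, where (C1) applies. With Cauchy-Schwarz and (A1) this gives a bound of
order `√(l Δt)` in the dual norm of `Q^{n,l}` (`inner_sub_le_sqrt`). By (C2) the increment is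
`H`-close to `I^l u^{n+l} - I^0 u^n ∈ V^{n,l}`, and the uniform Ehrling inequality (C3) turns the dual
bound into `‖u^{n+l} - u^n‖_H ≤ η (‖u^{n+l}‖ + ‖u^n‖) + D √(l Δt)` for `l Δt` small, with `η`
arbitrary (`norm_le_of_ehrling`). Squaring and summing, the translates by multiples of `Δt` tend to
`0` in `L²`, uniformly in the family (`sum_translate_sq_le`).

*Sampling.* Fix a small time `h` and let `l` be the least integer with `l Δt > h`. Averaging over
the residue classes modulo `l` gives a class such that the function that holds the value `u^n` for
`l` steps from each `n` in the class is `L²`-close to `u`, while the `V`-norms of these values are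
bounded in terms of `h` alone (`exists_good_residue`). Before its first sampling point, on an
interval of length at most `h`, the approximation is `0`, which (A2) makes harmless. Such functions
have at most `T / h + 1` nonzero pieces, with values in a compact subset of `H`, so they are sums of
boundedly many elements of the compact set of functions `1_{(-∞, a]} x` (`continuous_initialStep`,
`exists_isCompact_sum_mem`). The family is therefore totally bounded
(`totallyBounded_range_toLp_of_step`). Working with index shifts and
sampling makes translations by arbitrary reals and averages over time unnecessary.
-/

namespace MovingSpaces

/-! ### Sampling a finite sequence along a residue class -/

/-- Averaging over the `l` residue classes modulo `l`. -/
lemma exists_residue_sum_le (φ : ℕ → ℝ) (N : ℕ) {l : ℕ} (hl : 0 < l) :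
    ∃ r < l, (l : ℝ) * ∑ n ∈ Finset.range N with n % l = r, φ n ≤ ∑ n ∈ Finset.range N, φ n := by
  have hmaps : ∀ n ∈ Finset.range N, n % l ∈ Finset.range l := fun n _ =>
    Finset.mem_range.2 (Nat.mod_lt n hl)
  have hsum := Finset.sum_fiberwise_of_maps_to hmaps φ
  have hl' : (0 : ℝ) < l := by exact_mod_cast hl
  obtain ⟨r, hr, h⟩ := Finset.exists_le_of_sum_le (s := Finset.range l)
    (f := fun r => ∑ n ∈ Finset.range N with n % l = r, φ n)
    (g := fun _ => (∑ n ∈ Finset.range N, φ n) / l) ⟨0, Finset.mem_range.2 hl⟩ (by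
      rw [hsum, Finset.sum_const, Finset.card_range, nsmul_eq_mul, mul_div_cancel₀ _ hl'.ne'])
  refine ⟨r, Finset.mem_range.1 hr, ?_⟩
  rw [le_div_iff₀ hl'] at h
  linarith

lemma card_residue_le (N l r : ℕ) :
    ((Finset.range N).filter fun n => n % l = r).card ≤ N / l + 1 := by
  rw [← Finset.card_range (N / l + 1)]
  refine Finset.card_le_card_of_injOn (fun n => n / l) ?_ ?_
  · intro n hn
    simp only [Finset.coe_filter, Finset.mem_range, mem_ofPred_eq] at hn
    simp only [Finset.coe_range, mem_Iio]
    exact Nat.lt_succ_of_le (Nat.div_le_div_right hn.1.le)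
  · intro a ha b hb hab
    simp only [Finset.coe_filter, mem_ofPred_eq] at ha hb
    rw [← Nat.div_add_mod a l, ← Nat.div_add_mod b l, ha.2, hb.2]
    simp only at hab
    rw [hab]

/-- Every index `p ≥ r` lies in exactly one window `[n, n + l)` with `n ≡ r` modulo `l`. -/
lemma window_iff {l r n p : ℕ} (hr : r < l) (hp : r ≤ p) :
    (n % l = r ∧ n ≤ p ∧ p < n + l) ↔ n = p - (p - r) % l := by
  have hl : 0 < l := by omega
  have h1 := Nat.div_add_mod (p - r) l
  have h2 := Nat.mod_lt (p - r) hl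
  constructor
  · rintro ⟨h, hnp, hpn⟩
    have h3 := Nat.div_add_mod n l
    rw [h] at h3
    have h4 : p - r = (p - n) + l * (n / l) := by omega
    rw [h4, Nat.add_mul_mod_self_left, Nat.mod_eq_of_lt (by omega)]
    omega
  · intro h
    have h5 : n = r + l * ((p - r) / l) := by omega
    refine ⟨?_, by omega, by omega⟩
    rw [h5, Nat.add_mul_mod_self_left, Nat.mod_eq_of_lt hr]

/-- The sequence that equals `x n` on the window `[n, n + l)` for each `n < N`
with `n ≡ r` modulo `l`. -/
def sampled {E : Type*} [AddCommMonoid E] (x : ℕ → E) (N l r p : ℕ) : E :=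
  ∑ n ∈ Finset.range N with n % l = r, if n ≤ p ∧ p < n + l then x n else 0

variable {H : Type*} [NormedAddCommGroup H]

lemma sampled_of_lt (x : ℕ → H) {N l r p : ℕ} (hr : r < l) (hp : p < r) :
    sampled x N l r p = 0 := by
  refine Finset.sum_eq_zero fun n hn => if_neg ?_
  rintro ⟨h1, -⟩
  have := (Finset.mem_filter.1 hn).2
  rw [Nat.mod_eq_of_lt (by omega)] at this
  omega

lemma norm_sub_sampled_sq_le (x : ℕ → H) {N l r p : ℕ} (hr : r < l) (hp : r ≤ p) (hpN : p < N) :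
    ‖x p - sampled x N l r p‖ ^ 2 ≤ ∑ n ∈ Finset.range N with n % l = r,
      if n ≤ p ∧ p < n + l then ‖x p - x n‖ ^ 2 else 0 := by
  obtain ⟨h1, h2⟩ := (window_iff (n := p - (p - r) % l) hr hp).2 rfl
  have hmem : p - (p - r) % l ∈ (Finset.range N).filter fun n => n % l = r :=
    Finset.mem_filter.2 ⟨Finset.mem_range.2 (by omega), h1⟩
  have hs : sampled x N l r p = x (p - (p - r) % l) := by
    rw [sampled, Finset.sum_eq_single_of_mem _ hmem, if_pos h2]
    intro n hn hne
    refine if_neg fun h => hne ((window_iff hr hp).1 ⟨(Finset.mem_filter.1 hn).2, h⟩)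
  rw [hs]
  refine le_trans ?_ (Finset.single_le_sum (f := fun n =>
    if n ≤ p ∧ p < n + l then ‖x p - x n‖ ^ 2 else 0) (fun n _ => ?_) hmem)
  · rw [if_pos h2]
  · split_ifs <;> positivity

lemma sum_window (f : ℕ → ℝ) (N l n : ℕ) :
    ∑ p ∈ Finset.range N, (if n ≤ p ∧ p < n + l then f p else 0) =
      ∑ i ∈ Finset.range l, if n + i < N then f (n + i) else 0 := by
  have h : ∀ p, (if n ≤ p ∧ p < n + l then f p else 0) =
      ∑ i ∈ Finset.range l, if p = n + i then f p else 0 := by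
    intro p
    split_ifs with hp
    · rw [Finset.sum_eq_single_of_mem (p - n) (Finset.mem_range.2 (by omega))]
      · rw [if_pos (by omega)]
      · intro b _ hb
        exact if_neg (by omega)
    · exact (Finset.sum_eq_zero fun i hi => if_neg (by have := Finset.mem_range.1 hi; omega)).symm
  simp_rw [h]
  rw [Finset.sum_comm]
  refine Finset.sum_congr rfl fun i _ => ?_
  rw [Finset.sum_ite_eq']
  simp only [Finset.mem_range]

/-- The sampling error is controlled by the translates `x (· + i)` with `i < l`, summed over the
sampling points only; the first `r` terms are not sampled at all. -/
lemma sum_norm_sub_sampled_sq_le (x : ℕ → H) {N l r : ℕ} (hr : r < l) {M : ℝ}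
    (hM : ∀ p < N, ‖x p‖ ≤ M) :
    ∑ p ∈ Finset.range N, ‖x p - sampled x N l r p‖ ^ 2 ≤ r * M ^ 2 +
      ∑ n ∈ Finset.range N with n % l = r, ∑ i ∈ Finset.range l,
        if n + i < N then ‖x (n + i) - x n‖ ^ 2 else 0 := by
  have hpt : ∀ p ∈ Finset.range N, ‖x p - sampled x N l r p‖ ^ 2 ≤
      (if p < r then M ^ 2 else 0) + ∑ n ∈ Finset.range N with n % l = r,
        if n ≤ p ∧ p < n + l then ‖x p - x n‖ ^ 2 else 0 := by
    intro p hp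
    have hp' := Finset.mem_range.1 hp
    split_ifs with h
    · rw [sampled_of_lt x hr h, sub_zero]
      have h1 : ‖x p‖ ^ 2 ≤ M ^ 2 := pow_le_pow_left₀ (norm_nonneg _) (hM p hp') 2
      refine h1.trans (le_add_of_nonneg_right (Finset.sum_nonneg fun n _ => ?_))
      split_ifs <;> positivity
    · rw [zero_add]
      exact norm_sub_sampled_sq_le x hr (not_lt.1 h) hp'
  refine (Finset.sum_le_sum hpt).trans ?_
  rw [Finset.sum_add_distrib, Finset.sum_comm]
  refine add_le_add ?_ (Finset.sum_le_sum fun n _ =>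
    (sum_window (fun p => ‖x p - x n‖ ^ 2) N l n).le)
  rw [← Finset.sum_filter, Finset.sum_const, nsmul_eq_mul]
  refine mul_le_mul_of_nonneg_right ?_ (sq_nonneg M)
  have : ((Finset.range N).filter fun p => p < r) ⊆ Finset.range r := fun p hp =>
    Finset.mem_range.2 (Finset.mem_filter.1 hp).2
  exact_mod_cast (Finset.card_le_card this).trans_eq (Finset.card_range r)

/-- If the translates of `x` by fewer than `l` steps are close to `x` on average, then some
residue class modulo `l` samples `x` well, and at its points the weights `ν` are at most of the
size that the average of `ν` suggests. -/
lemma exists_good_residue (x : ℕ → H) (ν : ℕ → ℝ) {N l : ℕ} (hl : 0 < l) {M C ε τ : ℝ}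
    (hτ : 0 < τ) (hC : 0 < C) (hε : 0 < ε) (hM : ∀ p < N, ‖x p‖ ≤ M) (hν : ∀ p, 0 ≤ ν p)
    (hνC : (∑ p ∈ Finset.range N, ν p) * τ ≤ C)
    (htr : ∀ i < l, (∑ n ∈ Finset.range (N - i), ‖x (n + i) - x n‖ ^ 2) * τ ≤ ε) :
    ∃ r < l, (∀ n < N, n % l = r → ν n * (l * τ) ≤ 2 * C) ∧
      (∑ p ∈ Finset.range N, ‖x p - sampled x N l r p‖ ^ 2) * τ ≤ r * τ * M ^ 2 + 2 * ε := by
  have hl' : (0 : ℝ) < l := by exact_mod_cast hl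
  set ψ : ℕ → ℝ := fun n => ∑ i ∈ Finset.range l,
    if n + i < N then ‖x (n + i) - x n‖ ^ 2 else 0 with hψ
  have hψ0 : ∀ n, 0 ≤ ψ n := fun n => Finset.sum_nonneg fun i _ => by split_ifs <;> positivity
  have hψs : (∑ n ∈ Finset.range N, ψ n) * τ ≤ l * ε := by
    have : ∑ n ∈ Finset.range N, ψ n = ∑ i ∈ Finset.range l,
        ∑ n ∈ Finset.range (N - i), ‖x (n + i) - x n‖ ^ 2 := by
      rw [hψ, Finset.sum_comm]
      refine Finset.sum_congr rfl fun i _ => ?_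
      rw [← Finset.sum_filter]
      refine Finset.sum_congr ?_ fun _ _ => rfl
      ext n
      simp only [Finset.mem_filter, Finset.mem_range]
      omega
    rw [this, Finset.sum_mul]
    refine (Finset.sum_le_sum fun i hi => htr i (Finset.mem_range.1 hi)).trans_eq ?_
    rw [Finset.sum_const, Finset.card_range, nsmul_eq_mul]
  -- With these weights each of the two terms has a total of at most `C * ε * l` over all classes.
  obtain ⟨r, hr, h⟩ := exists_residue_sum_le (fun n => C * (ψ n * τ) + ε * (l * (ν n * τ))) N hl
  refine ⟨r, hr, ?_⟩
  have hR : ∑ n ∈ Finset.range N with n % l = r, (C * (ψ n * τ) + ε * (l * (ν n * τ))) =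
      C * ((∑ n ∈ Finset.range N with n % l = r, ψ n) * τ) +
        ε * (l * ((∑ n ∈ Finset.range N with n % l = r, ν n) * τ)) := by
    simp only [Finset.sum_add_distrib, ← Finset.mul_sum, ← Finset.sum_mul]
  have hA : ∑ n ∈ Finset.range N, (C * (ψ n * τ) + ε * (l * (ν n * τ))) =
      C * ((∑ n ∈ Finset.range N, ψ n) * τ) +
        ε * (l * ((∑ n ∈ Finset.range N, ν n) * τ)) := by
    simp only [Finset.sum_add_distrib, ← Finset.mul_sum, ← Finset.sum_mul]
  rw [hR, hA] at h
  have hψR : 0 ≤ (∑ n ∈ Finset.range N with n % l = r, ψ n) * τ :=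
    mul_nonneg (Finset.sum_nonneg fun n _ => hψ0 n) hτ.le
  have hνR : 0 ≤ l * ((∑ n ∈ Finset.range N with n % l = r, ν n) * τ) :=
    mul_nonneg hl'.le (mul_nonneg (Finset.sum_nonneg fun n _ => hν n) hτ.le)
  have h2 : C * ((∑ n ∈ Finset.range N with n % l = r, ψ n) * τ) +
        ε * (l * ((∑ n ∈ Finset.range N with n % l = r, ν n) * τ)) ≤ 2 * (C * ε) := by
    have e1 := mul_le_mul_of_nonneg_left hψs hC.le
    have e2 := mul_le_mul_of_nonneg_left (mul_le_mul_of_nonneg_left hνC hl'.le) hε.le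
    refine le_of_mul_le_mul_left ?_ hl'
    linarith
  have hψ2 : (∑ n ∈ Finset.range N with n % l = r, ψ n) * τ ≤ 2 * ε := by
    refine le_of_mul_le_mul_left ?_ hC
    have := mul_nonneg hε.le hνR
    linarith
  have hν2 : l * ((∑ n ∈ Finset.range N with n % l = r, ν n) * τ) ≤ 2 * C := by
    refine le_of_mul_le_mul_left ?_ hε
    have := mul_nonneg hC.le hψR
    linarith
  constructor
  · intro n hn hnr
    have h3 : ν n ≤ ∑ n ∈ Finset.range N with n % l = r, ν n :=
      Finset.single_le_sum (fun m _ => hν m)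
        (Finset.mem_filter.2 ⟨Finset.mem_range.2 hn, hnr⟩)
    have h4 := mul_le_mul_of_nonneg_right h3 (mul_nonneg hl'.le hτ.le)
    linarith
  · have h5 := mul_le_mul_of_nonneg_right (sum_norm_sub_sampled_sq_le x hr hM) hτ.le
    linarith

/-! ### Step functions with boundedly many jumps -/

/-- The class in `L²(0,T;H)` of the function equal to `x` on `(-∞, a]` and to `0` elsewhere. -/
noncomputable def initialStep (T a : ℝ) (x : H) : Lp H 2 (volume.restrict (Ioo 0 T)) :=
  indicatorConstLp 2 (measurableSet_Iic (a := a)) (measure_ne_top _ _) x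

lemma continuous_initialStep (T : ℝ) : Continuous fun z : H × ℝ => initialStep T z.2 z.1 := by
  refine continuous_prod_of_continuous_lipschitzWith _
    (Real.toNNReal ((volume.restrict (Ioo 0 T)).real univ ^ (1 / (2 : ℝ≥0∞).toReal)))
    (fun x => ?_) fun a => ?_
  · refine continuous_indicatorConstLp_set (by norm_num) fun a => ?_
    have hsub : ∀ b : ℝ, volume.restrict (Ioo 0 T) (symmDiff (Iic b) (Iic a)) ≤
        ENNReal.ofReal |b - a| := by
      intro b
      refine (Measure.restrict_le_self _).trans ?_
      refine (measure_mono (t := uIoc a b) ?_).trans_eq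
        (by rw [uIoc, Real.volume_Ioc, max_sub_min_eq_abs])
      intro t ht
      simp only [mem_symmDiff, mem_Iic, not_le] at ht
      rw [mem_uIoc]
      tauto
    refine tendsto_of_tendsto_of_tendsto_of_le_of_le tendsto_const_nhds ?_ (fun _ => zero_le) hsub
    have : Tendsto (fun b : ℝ => ENNReal.ofReal |b - a|) (𝓝 a) (𝓝 (ENNReal.ofReal |a - a|)) :=
      (ENNReal.continuous_ofReal.comp (by fun_prop : Continuous fun b : ℝ => |b - a|)).tendsto a
    simpa using this
  · refine LipschitzWith.of_dist_le_mul fun x y => ?_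
    rw [dist_eq_norm, dist_eq_norm, initialStep, initialStep, indicatorConstLp_sub,
      norm_indicatorConstLp (by norm_num) (by norm_num), mul_comm,
      Real.coe_toNNReal _ (by positivity)]
    refine mul_le_mul_of_nonneg_right ?_ (norm_nonneg _)
    refine Real.rpow_le_rpow measureReal_nonneg (measureReal_mono (subset_univ _)) (by positivity)

/-- The sums of at most `B` elements of a compact set stay in a compact set. -/
lemma exists_isCompact_sum_mem {E : Type*} [AddCommMonoid E] [TopologicalSpace E] [ContinuousAdd E]
    {S : Set E} (hS : IsCompact S) (B : ℕ) :
    ∃ S' : Set E, IsCompact S' ∧ ∀ (R : Finset ℕ) (y : ℕ → E), R.card ≤ B → (∀ n ∈ R, y n ∈ S) →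
      ∑ n ∈ R, y n ∈ S' := by
  induction B with
  | zero =>
    refine ⟨{0}, isCompact_singleton, fun R y hR _ => ?_⟩
    rw [Finset.card_eq_zero.1 (Nat.le_zero.1 hR)]
    simp
  | succ B ih =>
    obtain ⟨S', hS', h⟩ := ih
    refine ⟨S' ∪ (fun z : E × E => z.1 + z.2) '' (S ×ˢ S'),
      hS'.union ((hS.prod hS').image continuous_add), fun R y hR hy => ?_⟩
    rcases R.eq_empty_or_nonempty with rfl | ⟨n, hn⟩
    · exact Or.inl (h ∅ y (Nat.zero_le _) hy)
    · refine Or.inr ⟨(y n, ∑ m ∈ R.erase n, y m), ⟨hy n hn, h _ y ?_ fun m hm => ?_⟩,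
        Finset.add_sum_erase R y hn⟩
      · rw [Finset.card_erase_of_mem hn]
        omega
      · exact hy m (Finset.mem_of_mem_erase hm)

/-- The norm of a function in `L²(0,T;H)` that is constant on each cell of a uniform grid. -/
lemma norm_sq_eq_of_step {H : Type*} [NormedAddCommGroup H] [InnerProductSpace ℝ H]
    {T τ : ℝ} {N : ℕ} (hτ : 0 < τ) (hN : N * τ = T) (F : Lp H 2 (volume.restrict (Ioo 0 T)))
    {f : ℝ → H} (hF : F =ᵐ[volume.restrict (Ioo 0 T)] f) {z : ℕ → H}
    (hf : ∀ p < N, ∀ t ∈ Ioc (p * τ) ((p + 1 : ℕ) * τ), f t = z p) :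
    ‖F‖ ^ 2 = (∑ p ∈ Finset.range N, ‖z p‖ ^ 2) * τ := by
  have hle : ∀ p : ℕ, (p : ℝ) * τ ≤ (p + 1 : ℕ) * τ := fun p =>
    mul_le_mul_of_nonneg_right (by push_cast; linarith) hτ.le
  have hcell : ∀ p < N, ∫ t in (p * τ)..((p + 1 : ℕ) * τ), ‖f t‖ ^ 2 = ‖z p‖ ^ 2 * τ := by
    intro p hp
    rw [intervalIntegral.integral_of_le (hle p), setIntegral_congr_fun measurableSet_Ioc
      (g := fun _ => ‖z p‖ ^ 2) (fun t ht => by simp only [hf p hp t ht])]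
    rw [← intervalIntegral.integral_of_le (hle p), intervalIntegral.integral_const, smul_eq_mul]
    push_cast
    ring
  have hint : ∀ p < N, IntervalIntegrable (fun t => ‖f t‖ ^ 2) volume (p * τ)
      ((p + 1 : ℕ) * τ) := by
    intro p hp
    rw [intervalIntegrable_iff_integrableOn_Ioc_of_le (hle p)]
    refine (integrableOn_congr_fun (g := fun _ => ‖z p‖ ^ 2)
      (fun t ht => by simp only [hf p hp t ht]) measurableSet_Ioc).2 ?_
    exact integrableOn_const (by simp)
  have h0T : (0 : ℝ) ≤ T := hN ▸ by positivity
  have h1 : ‖F‖ ^ 2 = ∫ t in (0 : ℝ)..T, ‖f t‖ ^ 2 := by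
    rw [← real_inner_self_eq_norm_sq, L2.inner_def, intervalIntegral.integral_of_le h0T,
      integral_Ioc_eq_integral_Ioo]
    refine integral_congr_ae ?_
    filter_upwards [hF] with t ht
    rw [ht, real_inner_self_eq_norm_sq]
  have h2 := intervalIntegral.sum_integral_adjacent_intervals
    (a := fun p : ℕ => (p : ℝ) * τ) (f := fun t => ‖f t‖ ^ 2) (μ := volume) (n := N) hint
  rw [hN, Nat.cast_zero, zero_mul] at h2
  rw [h1, ← h2, Finset.sum_mul]
  exact Finset.sum_congr rfl fun p hp => hcell p (Finset.mem_range.1 hp)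

/-- The distance of a step function to the step function with the sampled values, the latter
written as a sum of two initial steps for each sampling point. -/
lemma norm_sub_sampled_sq_eq {H : Type*} [NormedAddCommGroup H] [InnerProductSpace ℝ H]
    {T τ : ℝ} {N : ℕ} (hτ : 0 < τ) (hN : N * τ = T) (l r : ℕ) {U : ℝ → H}
    (hU : MemLp U 2 (volume.restrict (Ioo 0 T))) {x : ℕ → H}
    (hUx : ∀ p < N, ∀ t ∈ Ioc (p * τ) ((p + 1 : ℕ) * τ), U t = x p) :
    ‖hU.toLp U - ∑ n ∈ Finset.range N with n % l = r,
        (initialStep T ((min (n + l) N : ℕ) * τ) (x n) + initialStep T (n * τ) (-x n))‖ ^ 2 =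
      (∑ p ∈ Finset.range N, ‖x p - sampled x N l r p‖ ^ 2) * τ := by
  set R := (Finset.range N).filter fun n => n % l = r with hR
  set s : ℕ → ℝ → H := fun n t => (Iic (((min (n + l) N : ℕ) : ℝ) * τ)).indicator (fun _ => x n) t +
    (Iic ((n : ℝ) * τ)).indicator (fun _ => -x n) t with hs
  refine norm_sq_eq_of_step hτ hN _ (f := fun t => U t - ∑ n ∈ R, s n t) ?_ ?_
  · have hstep : ∀ n, ⇑(initialStep T ((min (n + l) N : ℕ) * τ) (x n) +
        initialStep T (n * τ) (-x n)) =ᵐ[volume.restrict (Ioo 0 T)] s n := by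
      intro n
      filter_upwards [Lp.coeFn_add (initialStep T ((min (n + l) N : ℕ) * τ) (x n))
        (initialStep T (n * τ) (-x n)),
        indicatorConstLp_coeFn (p := 2) (μ := volume.restrict (Ioo 0 T))
          (hs := measurableSet_Iic (a := ((min (n + l) N : ℕ) : ℝ) * τ))
          (hμs := measure_ne_top _ _) (c := x n),
        indicatorConstLp_coeFn (p := 2) (μ := volume.restrict (Ioo 0 T))
          (hs := measurableSet_Iic (a := (n : ℝ) * τ))
          (hμs := measure_ne_top _ _) (c := -x n)] with t h1 h2 h3
      rw [h1, Pi.add_apply, initialStep, initialStep, h2, h3]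
    have hsum : ⇑(∑ n ∈ R, (initialStep T ((min (n + l) N : ℕ) * τ) (x n) +
        initialStep T (n * τ) (-x n))) =ᵐ[volume.restrict (Ioo 0 T)] fun t => ∑ n ∈ R, s n t := by
      have hall : ∀ᵐ t ∂(volume.restrict (Ioo 0 T)), ∀ n, (initialStep T ((min (n + l) N : ℕ) * τ)
          (x n) + initialStep T (n * τ) (-x n)) t = s n t := ae_all_iff.2 hstep
      filter_upwards [hall, Lp.coeFn_finsetSum R fun n => initialStep T ((min (n + l) N : ℕ) * τ)
        (x n) + initialStep T (n * τ) (-x n)] with t h1 h2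
      rw [h2, Finset.sum_apply]
      exact Finset.sum_congr rfl fun n _ => h1 n
    filter_upwards [Lp.coeFn_sub (hU.toLp U) (∑ n ∈ R,
      (initialStep T ((min (n + l) N : ℕ) * τ) (x n) + initialStep T (n * τ) (-x n))),
      hU.coeFn_toLp, hsum] with t h1 h2 h3
    rw [h1, Pi.sub_apply, h2, h3]
  · intro p hp t ht
    -- A point of the cell number `p` lies to the left of `m * τ` exactly if `p < m`.
    have hcmp : ∀ m : ℕ, t ≤ m * τ ↔ p < m := by
      intro m
      constructor
      · intro h
        have h1 : (p : ℝ) * τ < m * τ := ht.1.trans_le h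
        exact_mod_cast lt_of_mul_lt_mul_right h1 hτ.le
      · intro h
        refine ht.2.trans (mul_le_mul_of_nonneg_right ?_ hτ.le)
        exact_mod_cast h
    simp only [hUx p hp t ht, sampled]
    congr 1
    refine Finset.sum_congr rfl fun n _ => ?_
    simp only [hs, indicator_apply, mem_Iic, hcmp, lt_min_iff]
    by_cases h1 : p < n + l <;> by_cases h2 : p < n
    · rw [if_pos ⟨h1, hp⟩, if_pos h2, if_neg (by omega), add_neg_cancel]
    · rw [if_pos ⟨h1, hp⟩, if_neg h2, if_pos (by omega), add_zero]
    · omega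
    · rw [if_neg (by omega), if_neg h2, if_neg (by omega), add_zero]

/-! ### A discrete compactness criterion of Simon type -/

lemma totallyBounded_of_approx {E : Type*} [PseudoMetricSpace E] {S : Set E}
    (h : ∀ ε > 0, ∃ S' : Set E, IsCompact S' ∧ ∀ x ∈ S, ∃ y ∈ S', dist x y < ε) :
    TotallyBounded S := by
  refine Metric.totallyBounded_iff.2 fun ε hε => ?_
  obtain ⟨S', hS', hS⟩ := h (ε / 2) (half_pos hε)
  obtain ⟨t, ht, hcov⟩ := Metric.totallyBounded_iff.1 hS'.totallyBounded (ε / 2) (half_pos hε)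
  refine ⟨t, ht, fun x hx => ?_⟩
  obtain ⟨y, hy, hxy⟩ := hS x hx
  obtain ⟨c, hc, hyc⟩ := mem_iUnion₂.1 (hcov hy)
  refine mem_iUnion₂.2 ⟨c, hc, ?_⟩
  rw [Metric.mem_ball] at hyc ⊢
  linarith [dist_triangle x y c]

/-- A family of step functions on uniform grids of `(0, T]` is totally bounded in `L²(0,T;H)` if
its values are bounded in `H`, come from a family that is bounded in `L²(0,T;V)` with `V` compactly
embedded in `H`, and the translates by multiples of the step are uniformly continuous at `0`. -/
theorem totallyBounded_range_toLp_of_step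
    {V H : Type*} [NormedAddCommGroup V] [NormedSpace ℝ V]
    [NormedAddCommGroup H] [InnerProductSpace ℝ H]
    {emb : V →L[ℝ] H} (hemb : IsCompactOperator emb)
    {K : Type*} {T : ℝ} {N : K → ℕ} {dt : K → ℝ} (hdt0 : ∀ k, 0 < dt k)
    (hdt : ∀ k, (N k : ℝ) * dt k = T) {U : K → ℝ → H}
    (hU : ∀ k, MemLp (U k) 2 (volume.restrict (Ioo 0 T))) {x : K → ℕ → H} {v : K → ℕ → V}
    (hxv : ∀ k, ∀ p < N k, x k p = emb (v k p))
    (hUx : ∀ k, ∀ p < N k, ∀ t ∈ Ioc (p * dt k) ((p + 1 : ℕ) * dt k), U k t = x k p)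
    {M C : ℝ} (hC : 0 < C) (hM : ∀ k, ∀ p < N k, ‖x k p‖ ≤ M)
    (hvC : ∀ k, (∑ p ∈ Finset.range (N k), ‖v k p‖ ^ 2) * dt k ≤ C)
    (htr : ∀ ε > 0, ∃ h > 0, ∀ k, ∀ i : ℕ, 1 ≤ i → i * dt k ≤ h →
      (∑ n ∈ Finset.range (N k - i), ‖x k (n + i) - x k n‖ ^ 2) * dt k ≤ ε) :
    TotallyBounded (range fun k => (hU k).toLp (U k)) := by
  refine totallyBounded_of_approx fun ε hε => ?_
  obtain ⟨h₁, hh₁, htr₁⟩ := htr (ε ^ 2 / 8) (by positivity)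
  -- Blocks of length about `h`; the unsampled initial part contributes at most `h * M ^ 2`.
  set h : ℝ := min h₁ (ε ^ 2 / (4 * (M ^ 2 + 1)))
  have hh0 : 0 < h := lt_min hh₁ (by positivity)
  have hhM : h * M ^ 2 ≤ ε ^ 2 / 4 := by
    have h1 : h * (4 * (M ^ 2 + 1)) ≤ ε ^ 2 :=
      (le_div_iff₀ (by positivity)).1 (min_le_right _ _)
    nlinarith
  set ρ : ℝ := Real.sqrt (2 * C / h)
  set S₀ : Set H := closure (emb '' Metric.closedBall 0 ρ)
  have hS₀ : IsCompact S₀ := hemb.isCompact_closure_image_closedBall ρ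
  set S₁ : Set (Lp H 2 (volume.restrict (Ioo 0 T))) :=
    (fun z : H × ℝ => initialStep T z.2 z.1) '' (S₀ ×ˢ Icc 0 T)
  have hS₁ : IsCompact S₁ := (hS₀.prod isCompact_Icc).image (continuous_initialStep T)
  obtain ⟨S', hS', hsum⟩ := exists_isCompact_sum_mem
    ((hS₁.prod hS₁).image continuous_add) (⌊T / h⌋₊ + 1)
  refine ⟨S', hS', ?_⟩
  rintro _ ⟨k, rfl⟩
  set l : ℕ := ⌊h / dt k⌋₊ + 1
  have hl : (0 : ℝ) < l := by positivity
  have hlh : h ≤ l * dt k := by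
    have := (Nat.lt_floor_add_one (h / dt k)).le
    rw [div_le_iff₀ (hdt0 k)] at this
    exact_mod_cast this
  have hlt : ∀ i < l, (i : ℝ) * dt k ≤ h := by
    intro i hi
    rw [← le_div_iff₀ (hdt0 k)]
    exact (Nat.le_floor_iff (by have := hdt0 k; positivity)).1 (Nat.lt_succ_iff.1 hi)
  obtain ⟨r, hr, hν, herr⟩ := exists_good_residue (x k) (fun p => ‖v k p‖ ^ 2)
    (Nat.succ_pos ⌊h / dt k⌋₊) (hdt0 k) hC (show 0 < ε ^ 2 / 8 by positivity) (hM k)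
    (fun p => sq_nonneg _) (hvC k) (fun i hi => by
      rcases Nat.eq_zero_or_pos i with rfl | hi0
      · simp only [add_zero, sub_self, norm_zero, ne_eq, OfNat.ofNat_ne_zero, not_false_eq_true,
          zero_pow, Finset.sum_const_zero, zero_mul]
        positivity
      · exact htr₁ k i hi0 ((hlt i hi).trans (min_le_left _ _)))
  have hmem : ∀ n ∈ (Finset.range (N k)).filter fun n => n % l = r,
      x k n ∈ S₀ ∧ -x k n ∈ S₀ := by
    intro n hn
    obtain ⟨hn, hnr⟩ := Finset.mem_filter.1 hn
    have hn := Finset.mem_range.1 hn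
    have hb : ‖v k n‖ ≤ ρ := by
      refine Real.le_sqrt_of_sq_le ?_
      rw [le_div_iff₀ hh0]
      exact (mul_le_mul_of_nonneg_left hlh (sq_nonneg _)).trans (hν n hn hnr)
    refine ⟨subset_closure ⟨v k n, by simpa using hb, (hxv k n hn).symm⟩,
      subset_closure ⟨-v k n, by simpa using hb, ?_⟩⟩
    rw [map_neg, hxv k n hn]
  have hgrid : ∀ m ≤ N k, (m : ℝ) * dt k ∈ Icc 0 T := by
    intro m hm
    refine ⟨mul_nonneg (Nat.cast_nonneg m) (hdt0 k).le, ?_⟩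
    rw [← hdt k]
    exact mul_le_mul_of_nonneg_right (Nat.cast_le.2 hm) (hdt0 k).le
  refine ⟨_, hsum ((Finset.range (N k)).filter fun n => n % l = r)
    (fun n => initialStep T ((min (n + l) (N k) : ℕ) * dt k) (x k n) +
    initialStep T (n * dt k) (-x k n)) ?_ fun n hn => ?_, ?_⟩
  · refine (card_residue_le _ _ _).trans (Nat.add_le_add_right (Nat.le_floor ?_) 1)
    refine Nat.cast_div_le.trans ?_
    rw [div_le_div_iff₀ hl hh0, ← hdt k, mul_assoc, mul_comm (dt k)]
    exact mul_le_mul_of_nonneg_left hlh (Nat.cast_nonneg _)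
  · have hnN := (Finset.mem_range.1 (Finset.mem_filter.1 hn).1).le
    exact ⟨(_, _), ⟨⟨(x k n, _), ⟨(hmem n hn).1, hgrid _ (min_le_right _ _)⟩, rfl⟩,
      ⟨(-x k n, _), ⟨(hmem n hn).2, hgrid _ hnN⟩, rfl⟩⟩, rfl⟩
  · rw [dist_eq_norm]
    refine lt_of_pow_lt_pow_left₀ 2 hε.le ?_
    rw [norm_sub_sampled_sq_eq (hdt0 k) (hdt k) l r (hU k) (hUx k)]
    have h1 : r * dt k * M ^ 2 ≤ h * M ^ 2 :=
      mul_le_mul_of_nonneg_right (hlt r hr) (sq_nonneg M)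
    nlinarith [sq_pos_of_pos hε]

/-! ### Dual norms -/

lemma abs_inner_le_of_dualNorm_le {Q H : Type*} [NormedAddCommGroup Q] [NormedSpace ℝ Q]
    [NormedAddCommGroup H] [InnerProductSpace ℝ H] {e : Q →ₗ[ℝ] H} {w : H} {A : ℝ} (hA : 0 ≤ A)
    (h : dualNorm e w ≤ ENNReal.ofReal A) (q : Q) : |inner ℝ w (e q)| ≤ A * ‖q‖ := by
  rcases eq_or_ne q 0 with rfl | hq
  · simp
  have hq' : 0 < ‖q‖ := norm_pos_iff.2 hq
  have hunit : ‖(‖q‖⁻¹ • q)‖ ≤ 1 := by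
    rw [norm_smul, norm_inv, norm_norm, inv_mul_cancel₀ hq'.ne']
  have h1 := (le_iSup (fun p : {q : Q // ‖q‖ ≤ 1} => ENNReal.ofReal |inner ℝ w (e p)|)
    ⟨_, hunit⟩).trans h
  rw [ENNReal.ofReal_le_ofReal_iff hA] at h1
  simp only [map_smul, inner_smul_right, abs_mul, abs_inv, abs_norm] at h1
  rwa [inv_mul_le_iff₀ hq', mul_comm] at h1

lemma dualNorm_le_of_abs_inner_le {Q H : Type*} [NormedAddCommGroup Q] [NormedSpace ℝ Q]
    [NormedAddCommGroup H] [InnerProductSpace ℝ H] {e : Q →ₗ[ℝ] H} {w : H} {A : ℝ} (hA : 0 ≤ A)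
    (h : ∀ q, |inner ℝ w (e q)| ≤ A * ‖q‖) : dualNorm e w ≤ ENNReal.ofReal A :=
  iSup_le fun q => ENNReal.ofReal_le_ofReal
    ((h q).trans (mul_le_of_le_one_right hA q.2))

lemma inner_proj {Q H : Type*} [AddCommGroup Q] [Module ℝ Q] [NormedAddCommGroup H]
    [InnerProductSpace ℝ H] [CompleteSpace H] (e : Q →ₗ[ℝ] H) (z : H) (q : Q) :
    inner ℝ (proj e z) (e q) = inner ℝ z (e q) := by
  have : CompleteSpace (closureIn e) :=
    (Submodule.isClosed_topologicalClosure (LinearMap.range e)).completeSpace_coe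
  have hmem : e q ∈ closureIn e :=
    Submodule.le_topologicalClosure _ (LinearMap.mem_range_self e q)
  change inner ℝ ((closureIn e).starProjection z) (e q) = _
  rw [Submodule.inner_starProjection_left_eq_right, Submodule.starProjection_eq_self_iff.2 hmem]

/-! ### Increments of the sequence -/

/-- Summation by parts: the increment of `a` tested with a fixed `z` is compared with the sum of
its increments tested with moving approximations `b j` of `z`. -/
lemma inner_sub_le_sum {H : Type*} [NormedAddCommGroup H] [InnerProductSpace ℝ H] {a b : ℕ → H}
    {z : H} {l : ℕ} {α β : ℕ → ℝ} {M ρ : ℝ}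
    (hα : ∀ j < l, inner ℝ (a (j + 1) - a j) (b j) ≤ α j)
    (hβ : ∀ j < l, inner ℝ (b (j + 1) - b j) (a (j + 1)) ≤ β j)
    (ha0 : ‖a 0‖ ≤ M) (hal : ‖a l‖ ≤ M) (hb0 : ‖b 0 - z‖ ≤ ρ) (hbl : ‖b l - z‖ ≤ ρ) :
    inner ℝ (a l - a 0) z ≤ ∑ j ∈ Finset.range l, (α j + β j) + 2 * (M * ρ) := by
  have htel : inner ℝ (a l) (b l) - inner ℝ (a 0) (b 0) ≤
      ∑ j ∈ Finset.range l, (α j + β j) := by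
    rw [← Finset.sum_range_sub (fun j => (inner ℝ (a j) (b j) : ℝ))]
    refine Finset.sum_le_sum fun j hj => ?_
    have h1 := hα j (Finset.mem_range.1 hj)
    have h2 := hβ j (Finset.mem_range.1 hj)
    rw [inner_sub_left] at h1 h2
    rw [real_inner_comm, real_inner_comm _ (b j)] at h2
    linarith
  have hM : 0 ≤ M := (norm_nonneg _).trans ha0
  have hl : -inner ℝ (a l) (b l - z) ≤ M * ρ :=
    (neg_le_abs _).trans ((abs_real_inner_le_norm _ _).trans
      (mul_le_mul hal hbl (norm_nonneg _) hM))
  have h0 : inner ℝ (a 0) (b 0 - z) ≤ M * ρ :=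
    (le_abs_self _).trans ((abs_real_inner_le_norm _ _).trans
      (mul_le_mul ha0 hb0 (norm_nonneg _) hM))
  rw [inner_sub_right] at hl h0
  rw [inner_sub_left]
  linarith

lemma sum_mul_le_sqrt_mul_sqrt {ω : ℕ → ℝ} {l : ℕ} {τ C : ℝ} (hτ : 0 ≤ τ)
    (hω : (∑ j ∈ Finset.range l, ω j ^ 2) * τ ≤ C) :
    (∑ j ∈ Finset.range l, ω j) * τ ≤ Real.sqrt C * Real.sqrt (l * τ) := by
  have hC : 0 ≤ C := (mul_nonneg (Finset.sum_nonneg fun j _ => sq_nonneg _) hτ).trans hω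
  rw [← Real.sqrt_mul hC]
  refine Real.le_sqrt_of_sq_le ?_
  have h1 := sq_sum_le_card_mul_sum_sq (s := Finset.range l) (f := ω)
  rw [Finset.card_range] at h1
  calc ((∑ j ∈ Finset.range l, ω j) * τ) ^ 2 = (∑ j ∈ Finset.range l, ω j) ^ 2 * τ ^ 2 := by ring
    _ ≤ (l * ∑ j ∈ Finset.range l, ω j ^ 2) * τ ^ 2 :=
      mul_le_mul_of_nonneg_right h1 (sq_nonneg τ)
    _ = ((∑ j ∈ Finset.range l, ω j ^ 2) * τ) * (l * τ) := by ring
    _ ≤ C * (l * τ) := mul_le_mul_of_nonneg_right hω (by positivity)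

/-- An increment over the time `l * τ` is of order `√(l * τ)` when tested with an element `z` that
can be followed through the moving spaces; `s` stands for the norm of `z`. -/
lemma inner_sub_le_sqrt {H : Type*} [NormedAddCommGroup H] [InnerProductSpace ℝ H] {a b : ℕ → H}
    {z : H} {l : ℕ} {ω : ℕ → ℝ} {τ T C M c₁ c₂ s : ℝ} (hτ : 0 ≤ τ) (hT : l * τ ≤ T)
    (hω : (∑ j ∈ Finset.range l, ω j ^ 2) * τ ≤ C) (hc₁ : 0 ≤ c₁) (hc₂ : 0 ≤ c₂) (hs : 0 ≤ s)
    (h₁ : ∀ j < l, inner ℝ (a (j + 1) - a j) (b j) ≤ c₁ * τ * (ω j + 1) * s)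
    (h₂ : ∀ j < l, inner ℝ (b (j + 1) - b j) (a (j + 1)) ≤ c₂ * τ * s * ω j)
    (ha : ∀ j ≤ l, ‖a j‖ ≤ M) (hb : ∀ j ≤ l, ‖b j - z‖ ≤ c₂ * Real.sqrt (l * τ) * s) :
    inner ℝ (a l - a 0) z ≤
      (c₁ * (Real.sqrt C + Real.sqrt T) + c₂ * Real.sqrt C + 2 * (M * c₂)) *
        Real.sqrt (l * τ) * s := by
  refine (inner_sub_le_sum h₁ h₂ (ha 0 (Nat.zero_le l)) (ha l le_rfl) (hb 0 (Nat.zero_le l))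
    (hb l le_rfl)).trans ?_
  have hsum : ∑ j ∈ Finset.range l, (c₁ * τ * (ω j + 1) * s + c₂ * τ * s * ω j) =
      (c₁ * ((∑ j ∈ Finset.range l, ω j) * τ + l * τ) +
        c₂ * ((∑ j ∈ Finset.range l, ω j) * τ)) * s := by
    have : ∀ j, c₁ * τ * (ω j + 1) * s + c₂ * τ * s * ω j =
        ω j * ((c₁ + c₂) * τ * s) + c₁ * τ * s := fun j => by ring
    simp only [this, Finset.sum_add_distrib, ← Finset.sum_mul, Finset.sum_const,
      Finset.card_range, nsmul_eq_mul]
    ring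
  have hω' := sum_mul_le_sqrt_mul_sqrt hτ hω
  have hlτ : l * τ ≤ Real.sqrt T * Real.sqrt (l * τ) := by
    have h0 : 0 ≤ l * τ := by positivity
    calc l * τ = Real.sqrt (l * τ) * Real.sqrt (l * τ) := (Real.mul_self_sqrt h0).symm
      _ ≤ _ := mul_le_mul_of_nonneg_right (Real.sqrt_le_sqrt hT) (Real.sqrt_nonneg _)
  rw [hsum]
  have h3 : c₁ * ((∑ j ∈ Finset.range l, ω j) * τ + l * τ) +
      c₂ * ((∑ j ∈ Finset.range l, ω j) * τ) ≤
      c₁ * (Real.sqrt C * Real.sqrt (l * τ) + Real.sqrt T * Real.sqrt (l * τ)) +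
        c₂ * (Real.sqrt C * Real.sqrt (l * τ)) := by gcongr
  have h4 := mul_le_mul_of_nonneg_right h3 hs
  linarith

/-- The Ehrling inequality turns a bound of `d` in a dual norm into a bound in `H`, if `d` is
close to an element of the closure of the test space. -/
lemma norm_le_of_ehrling {V H Q : Type*} [NormedAddCommGroup V] [NormedSpace ℝ V]
    [NormedAddCommGroup H] [InnerProductSpace ℝ H] [NormedAddCommGroup Q] [NormedSpace ℝ Q]
    {emb : V →L[ℝ] H} {e : Q →ₗ[ℝ] V} {y : closureIn e} {d : H} {A B γ δ D : ℝ} (hA : 0 ≤ A)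
    (hB : 0 ≤ B) (hδ : 0 ≤ δ) (hD : 0 ≤ D) (hd : ∀ q, |inner ℝ d (emb (e q))| ≤ A * ‖q‖)
    (he : ∀ q, ‖emb (e q)‖ ≤ B * ‖q‖) (hy : ‖emb (y : V) - d‖ ≤ γ)
    (hE : ENNReal.ofReal ‖emb (y : V)‖ ≤ ENNReal.ofReal (δ * ‖y‖) +
      ENNReal.ofReal D * dualNorm (emb.toLinearMap ∘ₗ e) (emb (y : V))) :
    ‖d‖ ≤ γ + δ * ‖y‖ + D * (B * γ + A) := by
  have hγ : 0 ≤ γ := (norm_nonneg _).trans hy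
  have hdual : dualNorm (emb.toLinearMap ∘ₗ e) (emb (y : V)) ≤ ENNReal.ofReal (B * γ + A) := by
    refine dualNorm_le_of_abs_inner_le (by positivity) fun q => ?_
    change |inner ℝ (emb (y : V)) (emb (e q))| ≤ _
    have h1 : |inner ℝ (emb (y : V) - d) (emb (e q))| ≤ γ * (B * ‖q‖) :=
      (abs_real_inner_le_norm _ _).trans (mul_le_mul hy (he q) (norm_nonneg _) hγ)
    rw [← sub_add_cancel (emb (y : V)) d, inner_add_left]
    refine (abs_add_le _ _).trans ((add_le_add h1 (hd q)).trans_eq (by ring))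
  have h2 : ‖emb (y : V)‖ ≤ δ * ‖y‖ + D * (B * γ + A) := by
    rw [← ENNReal.ofReal_le_ofReal_iff (by positivity), ENNReal.ofReal_add (by positivity)
      (by positivity), ENNReal.ofReal_mul hD]
    exact hE.trans (add_le_add le_rfl (mul_le_mul_right hdual _))
  have h3 := norm_sub_norm_le d (emb (y : V))
  rw [norm_sub_rev] at h3
  linarith

lemma sum_translate_sq_le {H : Type*} [NormedAddCommGroup H] {x : ℕ → H} {ω : ℕ → ℝ} {N l : ℕ}
    {τ C T η E : ℝ} (hτ : 0 ≤ τ) (hT : N * τ = T)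
    (hω : (∑ p ∈ Finset.range N, ω p ^ 2) * τ ≤ C)
    (h : ∀ n, n + l < N → ‖x (n + l) - x n‖ ≤ η * (ω (n + l) + ω n) + E) :
    (∑ n ∈ Finset.range (N - l), ‖x (n + l) - x n‖ ^ 2) * τ ≤
      8 * η ^ 2 * C + 2 * E ^ 2 * T := by
  have hpt : ∀ n ∈ Finset.range (N - l), ‖x (n + l) - x n‖ ^ 2 ≤
      4 * η ^ 2 * (ω (n + l) ^ 2 + ω n ^ 2) + 2 * E ^ 2 := by
    intro n hn
    have h1 := pow_le_pow_left₀ (norm_nonneg _)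
      (h n (by have := Finset.mem_range.1 hn; omega)) 2
    nlinarith [sq_nonneg (η * (ω (n + l) + ω n) - E), sq_nonneg (η * (ω (n + l) - ω n))]
  have hsub : ∑ n ∈ Finset.range (N - l), ω n ^ 2 ≤ ∑ n ∈ Finset.range N, ω n ^ 2 :=
    Finset.sum_le_sum_of_subset_of_nonneg
      (Finset.range_subset_range.2 (Nat.sub_le N l)) fun n _ _ => sq_nonneg _
  have hshift : ∑ n ∈ Finset.range (N - l), ω (n + l) ^ 2 ≤ ∑ n ∈ Finset.range N, ω n ^ 2 := by
    rw [← Finset.sum_image (s := Finset.range (N - l)) (g := fun n => n + l)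
      (f := fun n => ω n ^ 2) fun a _ b _ hab => Nat.add_right_cancel hab]
    refine Finset.sum_le_sum_of_subset_of_nonneg (fun m hm => ?_) fun n _ _ => sq_nonneg _
    obtain ⟨n, hn, rfl⟩ := Finset.mem_image.1 hm
    have := Finset.mem_range.1 hn
    exact Finset.mem_range.2 (by omega)
  have hcard : ((N - l : ℕ) : ℝ) ≤ N := Nat.cast_le.2 (Nat.sub_le N l)
  calc (∑ n ∈ Finset.range (N - l), ‖x (n + l) - x n‖ ^ 2) * τ
      ≤ (∑ n ∈ Finset.range (N - l),
          (4 * η ^ 2 * (ω (n + l) ^ 2 + ω n ^ 2) + 2 * E ^ 2)) * τ :=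
        mul_le_mul_of_nonneg_right (Finset.sum_le_sum hpt) hτ
    _ = (4 * η ^ 2 * (∑ n ∈ Finset.range (N - l), ω (n + l) ^ 2 +
          ∑ n ∈ Finset.range (N - l), ω n ^ 2) + (N - l : ℕ) * (2 * E ^ 2)) * τ := by
        rw [Finset.sum_add_distrib, ← Finset.mul_sum, Finset.sum_add_distrib, Finset.sum_const,
          Finset.card_range, nsmul_eq_mul]
    _ ≤ (4 * η ^ 2 * (∑ n ∈ Finset.range N, ω n ^ 2 + ∑ n ∈ Finset.range N, ω n ^ 2) +
          N * (2 * E ^ 2)) * τ := by gcongr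
    _ = 8 * η ^ 2 * ((∑ n ∈ Finset.range N, ω n ^ 2) * τ) + 2 * E ^ 2 * (N * τ) := by ring
    _ ≤ _ := by rw [hT]; gcongr

/-- An essential bound holds at every value that is attained on a nonempty open interval. -/
lemma norm_le_of_eLpNorm_top_le {H : Type*} [NormedAddCommGroup H] {U : ℝ → H} {T M a b : ℝ}
    {x : H} (hM : 0 ≤ M) (ha : 0 ≤ a) (hab : a < b) (hb : b ≤ T)
    (hU : eLpNorm U ∞ (volume.restrict (Ioo 0 T)) ≤ ENNReal.ofReal M)
    (hx : ∀ t ∈ Ioo a b, U t = x) : ‖x‖ ≤ M := by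
  rw [eLpNorm_exponent_top] at hU
  have h1 : ∀ᵐ t ∂volume.restrict (Ioo a b), ‖U t‖ₑ ≤ ENNReal.ofReal M :=
    ae_restrict_of_ae_restrict_of_subset (Ioo_subset_Ioo ha hb)
      ((ae_le_eLpNormEssSup (f := U)).mono fun t ht => ht.trans hU)
  have h2 : ∀ᵐ t ∂volume.restrict (Ioo a b), t ∈ Ioo a b := ae_restrict_mem measurableSet_Ioo
  have : (ae (volume.restrict (Ioo a b))).NeBot := by
    rw [ae_neBot, Ne, Measure.restrict_eq_zero, Real.volume_Ioo, ENNReal.ofReal_eq_zero, not_le]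
    linarith
  obtain ⟨t, ht1, ht2⟩ := (h1.and h2).exists
  rw [hx t ht2, ← ofReal_norm, ENNReal.ofReal_le_ofReal_iff hM] at ht1
  exact ht1

end MovingSpaces

/-! ### Compactness in moving Hilbert spaces -/

theorem theorem1
    -- the Hilbert spaces `V ⊂⊂ H`
    {V H : Type*}
    [NormedAddCommGroup V] [InnerProductSpace ℝ V] [CompleteSpace V]
    [NormedAddCommGroup H] [InnerProductSpace ℝ H] [CompleteSpace H]
    (emb : V →L[ℝ] H) (hemb_inj : Function.Injective emb) (hemb_cpt : IsCompactOperator emb)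
    -- the time interval `(0,T)` and the time steps: the index `k` stands for `Δt = dt k = T / N k`
    {K : Type*} (T : ℝ) (hT : 0 < T) (N : K → ℕ) (hN : ∀ k, 1 ≤ N k)
    (dt : K → ℝ) (hdt : ∀ k, (N k : ℝ) * dt k = T)
    -- the Hilbert spaces `V^n`, `Q^n`, embedded in `V` uniformly in `Δt` and `n`
    (Vn : K → ℕ → Type*)
    [∀ k n, NormedAddCommGroup (Vn k n)] [∀ k n, InnerProductSpace ℝ (Vn k n)]
    [∀ k n, CompleteSpace (Vn k n)]
    (Qn : K → ℕ → Type*)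
    [∀ k n, NormedAddCommGroup (Qn k n)] [∀ k n, InnerProductSpace ℝ (Qn k n)]
    [∀ k n, CompleteSpace (Qn k n)]
    (eV : ∀ k n, Vn k n →L[ℝ] V) (eQ : ∀ k n, Qn k n →L[ℝ] V)
    (heV_inj : ∀ k n, 1 ≤ n → n ≤ N k → Function.Injective (eV k n))
    (heQ_inj : ∀ k n, n ≤ N k → Function.Injective (eQ k n))
    (heV : ∃ C : ℝ, ∀ k n, 1 ≤ n → n ≤ N k → ∀ v : Vn k n, ‖eV k n v‖ ≤ C * ‖v‖)
    (heQ : ∃ C : ℝ, ∀ k n, n ≤ N k → ∀ q : Qn k n, ‖eQ k n q‖ ≤ C * ‖q‖)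
    -- `V^n` lies in the closure of `Q^n` in `H`
    -- (compactly, since `V ⊂⊂ H`; that closure embeds in `(Q^n)'` by density of `Q^n`)
    (hVQ : ∀ k n, 1 ≤ n → n ≤ N k → ∀ v : Vn k n,
      emb (eV k n v) ∈ MovingSpaces.closureIn (emb ∘L eQ k n : Qn k n →L[ℝ] H).toLinearMap)
    -- the values `u^n`, `n = 0,…,N`, in `H`; those with `n ≥ 1` come from elements `w^n` of `V^n`
    (u : K → ℕ → H) (w : ∀ k n, Vn k n)
    (huw : ∀ k n, 1 ≤ n → n ≤ N k → u k n = emb (eV k n (w k n)))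
    -- the functions `u_Δt ∈ L²(0,T;H)`
    (U : K → ℝ → H)
    (hU : ∀ k, MemLp (U k) 2 (volume.restrict (Ioo 0 T)))
    (hUu : ∀ k n, 1 ≤ n → n ≤ N k →
      ∀ t ∈ Ioc (((n : ℝ) - 1) * dt k) ((n : ℝ) * dt k), U k t = u k n)
    -- (A1)
    (hA1 : ∃ C : ℝ, 0 < C ∧ ∀ k, ∑ n ∈ Finset.Icc 1 (N k), ‖w k n‖ ^ 2 * dt k ≤ C)
    -- (A2)
    (hA2 : ∃ C : ℝ, 0 < C ∧ ∀ k,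
      eLpNorm (U k) ∞ (volume.restrict (Ioo 0 T)) ≤ ENNReal.ofReal C)
    -- (A3)
    (hA3 : ∃ C : ℝ, 0 < C ∧ ∀ k,
      eLpNorm (fun t => U k (t - dt k) - U k t) 2 (volume.restrict (Ioo (dt k) T)) ^ 2
        ≤ ENNReal.ofReal (C * dt k))
    -- (B)
    (hB : ∃ C : ℝ, 0 < C ∧ ∀ k n, n < N k →
      MovingSpaces.dualNorm (emb ∘L eQ k n : Qn k n →L[ℝ] H).toLinearMap
          (MovingSpaces.proj (emb ∘L eQ k n : Qn k n →L[ℝ] H).toLinearMap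
            ((dt k)⁻¹ • (u k (n + 1) - u k n)))
        ≤ ENNReal.ofReal (C * (‖w k (n + 1)‖ + 1)))
    -- (C1): the common test spaces `Q^{n,l} ⊂ V` and the maps `J^j : Q^{n,l} → Q^{n+j}`
    (Qc : K → ℕ → ℕ → Type*)
    [∀ k n l, NormedAddCommGroup (Qc k n l)] [∀ k n l, NormedSpace ℝ (Qc k n l)]
    (eC : ∀ k n l, Qc k n l →ₗ[ℝ] V)
    (heC_inj : ∀ k n l, 1 ≤ l → 1 ≤ n → n + l ≤ N k → Function.Injective (eC k n l))
    (J : ∀ k n l j, Qc k n l → Qn k (n + j))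
    (hC1 : ∃ C : ℝ, 0 < C ∧ ∀ k n l, 1 ≤ l → 1 ≤ n → n + l ≤ N k → ∀ q : Qc k n l,
      (∀ j, j ≤ l → ‖J k n l j q‖ ≤ C * ‖q‖) ∧
      (∀ j, j < l →
        inner ℝ (emb (eQ k (n + (j + 1)) (J k n l (j + 1) q)) - emb (eQ k (n + j) (J k n l j q)))
            (u k (n + j + 1))
          ≤ C * dt k * ‖q‖ * ‖w k (n + j + 1)‖) ∧
      (∀ j, j ≤ l →
        ‖emb (eQ k (n + j) (J k n l j q)) - emb (eC k n l q)‖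
          ≤ C * Real.sqrt (l * dt k) * ‖q‖))
    -- (C2): the maps `I^j : V^{n+j} → V^{n,l}`, where `V^{n,l}` is the closure of `Q^{n,l}` in `V`
    (I : ∀ k n l j, Vn k (n + j) → MovingSpaces.closureIn (eC k n l))
    (hC2_bdd : ∃ C : ℝ, 0 < C ∧ ∀ k n l, 1 ≤ l → 1 ≤ n → n + l ≤ N k → ∀ j, j ≤ l →
      ∀ v : Vn k (n + j), ‖I k n l j v‖ ≤ C * ‖v‖)
    (g : ℝ → ℝ) (hg_nonneg : ∀ h, 0 < h → 0 ≤ g h) (hg_mono : MonotoneOn g (Ioi 0))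
    (hg_lim : Tendsto g (𝓝[>] 0) (𝓝 0))
    (hC2_approx : ∀ k n l, 1 ≤ l → 1 ≤ n → n + l ≤ N k → ∀ j, j ≤ l →
      ∀ v : Vn k (n + j),
        ‖emb (I k n l j v : V) - emb (eV k (n + j) v)‖ ≤ g (l * dt k) * ‖v‖)
    -- (C3): uniform Ehrling property
    (hC3 : ∀ δ : ℝ, 0 < δ → ∃ C : ℝ, 0 < C ∧
      ∀ k n l, 1 ≤ l → 1 ≤ n → n + l ≤ N k → ∀ v : MovingSpaces.closureIn (eC k n l),
        ENNReal.ofReal ‖emb (v : V)‖ ≤ ENNReal.ofReal (δ * ‖v‖)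
          + ENNReal.ofReal C *
            MovingSpaces.dualNorm (emb.toLinearMap ∘ₗ eC k n l) (emb (v : V))) :
    IsCompact (closure (Set.range fun k => (hU k).toLp (U k))) := by
  obtain ⟨CV, hCV⟩ := heV
  obtain ⟨CQ, hCQ⟩ := heQ
  obtain ⟨CA, hCA0, hCA⟩ := hA1
  obtain ⟨M, hM0, hM⟩ := hA2
  obtain ⟨CB, hCB0, hCB⟩ := hB
  obtain ⟨C₁, hC₁0, hC₁⟩ := hC1
  obtain ⟨C₂, hC₂0, hC₂⟩ := hC2_bdd
  have hN0 : ∀ k, (0 : ℝ) < N k := fun k => Nat.cast_pos.2 (hN k)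
  have hdt0 : ∀ k, 0 < dt k := fun k => by
    have h := hdt k ▸ hT
    exact (pos_iff_pos_of_mul_pos h).1 (hN0 k)
  have hle : ∀ k, ∀ m ≤ N k, (m : ℝ) * dt k ≤ T := fun k m hm => by
    rw [← hdt k]
    exact mul_le_mul_of_nonneg_right (Nat.cast_le.2 hm) (hdt0 k).le
  have huM : ∀ k n, 1 ≤ n → n ≤ N k → ‖u k n‖ ≤ M := fun k n h1 hn => by
    have h1' : (1 : ℝ) ≤ n := by exact_mod_cast h1
    refine MovingSpaces.norm_le_of_eLpNorm_top_le hM0.le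
      (mul_nonneg (sub_nonneg.2 h1') (hdt0 k).le)
      (mul_lt_mul_of_pos_right (sub_one_lt _) (hdt0 k)) (hle k n hn) (hM k)
      fun t ht => hUu k n h1 hn t (Ioo_subset_Ioc_self ht)
  have hsumA : ∀ k n l, n + l ≤ N k →
      (∑ j ∈ Finset.range l, ‖w k (n + j + 1)‖ ^ 2) * dt k ≤ CA := fun k n l hn => by
    refine le_trans ?_ (hCA k)
    rw [← Finset.sum_mul]
    refine mul_le_mul_of_nonneg_right ?_ (hdt0 k).le
    rw [← Finset.sum_image (s := Finset.range l) (g := fun j => n + j + 1)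
      (f := fun m => ‖w k m‖ ^ 2) fun a _ b _ hab => by simpa using hab]
    refine Finset.sum_le_sum_of_subset_of_nonneg (fun m hm => ?_) fun n _ _ => sq_nonneg _
    obtain ⟨j, hj, rfl⟩ := Finset.mem_image.1 hm
    have := Finset.mem_range.1 hj
    exact Finset.mem_Icc.2 (by omega)
  have hsumA' : ∀ k, (∑ p ∈ Finset.range (N k), ‖w k (p + 1)‖ ^ 2) * dt k ≤ CA := fun k => by
    have h := hsumA k 0 (N k) (by omega)
    rwa [Finset.sum_congr rfl fun p _ => by rw [zero_add]] at h
  -- `A` bounds the dual norms of the increments, and `B` the embedding of `Q^{n,l}` in `H`.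
  set A : ℝ := CB * C₁ * (Real.sqrt CA + Real.sqrt T) + C₁ * Real.sqrt CA + 2 * (M * C₁)
  have hA : 0 ≤ A := by positivity
  set B : ℝ := ‖emb‖ * (|CQ| * C₁) + C₁ * Real.sqrt T
  have hB : 0 ≤ B := by positivity
  have hdual : ∀ k n l, 1 ≤ l → 1 ≤ n → n + l ≤ N k → ∀ q : Qc k n l,
      |inner ℝ (u k (n + l) - u k n) (emb (eC k n l q))| ≤ A * Real.sqrt (l * dt k) * ‖q‖ := by
    intro k n l hl hn hnl
    have key : ∀ q : Qc k n l, inner ℝ (u k (n + l) - u k (n + 0)) (emb (eC k n l q)) ≤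
        A * Real.sqrt (l * dt k) * ‖q‖ := by
      intro q
      obtain ⟨hJ, hJinc, hJapp⟩ := hC₁ k n l hl hn hnl q
      refine MovingSpaces.inner_sub_le_sqrt (a := fun j => u k (n + j))
        (b := fun j => emb (eQ k (n + j) (J k n l j q))) (ω := fun j => ‖w k (n + j + 1)‖)
        (hdt0 k).le (hle k l (by omega)) ?_ (by positivity) hC₁0.le (norm_nonneg q) ?_ hJinc ?_
        hJapp
      · exact hsumA k n l hnl
      · intro j hj
        have h1 := MovingSpaces.abs_inner_le_of_dualNorm_le
          (mul_nonneg hCB0.le (add_nonneg (norm_nonneg (w k (n + j + 1))) zero_le_one))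
          (hCB k (n + j) (by omega)) (J k n l j q)
        rw [MovingSpaces.inner_proj, inner_smul_left] at h1
        have h2 := (le_abs_self _).trans h1
        have h3 := mul_le_mul_of_nonneg_left (hJ j hj.le)
          (mul_nonneg hCB0.le (add_nonneg (norm_nonneg (w k (n + j + 1))) zero_le_one))
        have h4 := h2.trans h3
        rw [RCLike.conj_to_real, inv_mul_le_iff₀ (hdt0 k)] at h4
        exact h4.trans_eq (by ring)
      · intro j hj
        exact huM k (n + j) (by omega) (by omega)
    intro q
    refine abs_le.2 ⟨?_, key q⟩
    -- The maps `J^j` need not be odd, but the one-sided bound also applies to `-q`.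
    have h := key (-q)
    rw [map_neg, map_neg, inner_neg_right, norm_neg, add_zero] at h
    linarith
  have hBe : ∀ k n l, 1 ≤ l → 1 ≤ n → n + l ≤ N k → ∀ q : Qc k n l,
      ‖emb (eC k n l q)‖ ≤ B * ‖q‖ := by
    intro k n l hl hn hnl q
    obtain ⟨hJ, -, hJapp⟩ := hC₁ k n l hl hn hnl q
    have h1 : ‖emb (eQ k (n + 0) (J k n l 0 q))‖ ≤ ‖emb‖ * (|CQ| * (C₁ * ‖q‖)) := by
      refine (emb.le_opNorm _).trans (mul_le_mul_of_nonneg_left ?_ (norm_nonneg _))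
      refine (hCQ k (n + 0) (by omega) _).trans ?_
      exact mul_le_mul (le_abs_self _) (hJ 0 (Nat.zero_le l)) (norm_nonneg _) (abs_nonneg _)
    have h2 := hJapp 0 (Nat.zero_le l)
    have h3 : C₁ * Real.sqrt (l * dt k) * ‖q‖ ≤ C₁ * Real.sqrt T * ‖q‖ := by
      have := Real.sqrt_le_sqrt (hle k l (by omega))
      gcongr
    have h4 := norm_sub_norm_le (emb (eC k n l q)) (emb (eQ k (n + 0) (J k n l 0 q)))
    rw [norm_sub_rev] at h4
    simp only [B]
    linarith
  -- Increments over short times are small, up to the norms that (A1) controls.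
  have hinc : ∀ η > 0, ∃ D ≥ 0, ∃ h > 0, ∀ k n l, 1 ≤ l → 1 ≤ n → n + l ≤ N k →
      l * dt k ≤ h → ‖u k (n + l) - u k n‖ ≤
        η * (‖w k (n + l)‖ + ‖w k n‖) + D * Real.sqrt (l * dt k) := by
    intro η hη
    obtain ⟨D, hD0, hD⟩ := hC3 (η / (2 * C₂)) (by positivity)
    have hgη : ∀ᶠ h in 𝓝[>] (0 : ℝ), g h < η / (2 * (1 + D * B)) :=
      hg_lim.eventually_lt_const (by positivity)
    obtain ⟨h, hh0, hh⟩ := mem_nhdsGT_iff_exists_Ioo_subset.1 hgη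
    have hh0 : 0 < h := hh0
    refine ⟨D * A, by positivity, h / 2, half_pos hh0, fun k n l hl hn hnl hlh => ?_⟩
    have hlpos : 0 < l * dt k := mul_pos (Nat.cast_pos.2 hl) (hdt0 k)
    have hg1 : g (l * dt k) < η / (2 * (1 + D * B)) := hh ⟨hlpos, by linarith⟩
    rw [lt_div_iff₀ (by positivity)] at hg1
    set σ : ℝ := ‖w k (n + l)‖ + ‖w k n‖
    have hσ : 0 ≤ σ := by positivity
    set y : MovingSpaces.closureIn (eC k n l) :=
      I k n l l (w k (n + l)) - I k n l 0 (w k (n + 0))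
    have hy : ‖y‖ ≤ C₂ * σ := by
      refine (norm_sub_le _ _).trans ?_
      have h1 := hC₂ k n l hl hn hnl l le_rfl (w k (n + l))
      have h2 := hC₂ k n l hl hn hnl 0 (Nat.zero_le l) (w k (n + 0))
      exact (add_le_add h1 h2).trans_eq (mul_add _ _ _).symm
    have hyd : ‖emb (y : V) - (u k (n + l) - u k n)‖ ≤ g (l * dt k) * σ := by
      have h1 := hC2_approx k n l hl hn hnl l le_rfl (w k (n + l))
      have h2 := hC2_approx k n l hl hn hnl 0 (Nat.zero_le l) (w k (n + 0))
      rw [← huw k (n + l) (by omega) hnl] at h1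
      rw [← huw k (n + 0) (by omega) (by omega)] at h2
      have h3 : emb (y : V) - (u k (n + l) - u k n) =
          (emb (I k n l l (w k (n + l)) : V) - u k (n + l)) -
            (emb (I k n l 0 (w k (n + 0)) : V) - u k (n + 0)) := by
        simp only [y, Submodule.coe_sub, map_sub, add_zero]
        abel
      rw [h3]
      exact (norm_sub_le _ _).trans ((add_le_add h1 h2).trans_eq (mul_add _ _ _).symm)
    have hmain := MovingSpaces.norm_le_of_ehrling
      (mul_nonneg hA (Real.sqrt_nonneg _)) hB (by positivity) hD0.le (hdual k n l hl hn hnl)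
      (hBe k n l hl hn hnl) hyd (hD k n l hl hn hnl y)
    have h1 : η / (2 * C₂) * ‖y‖ ≤ η / 2 * σ := by
      refine (mul_le_mul_of_nonneg_left hy (by positivity)).trans_eq ?_
      field_simp
    have h2 := mul_le_mul_of_nonneg_right hg1.le hσ
    linarith
  have htot := MovingSpaces.totallyBounded_range_toLp_of_step hemb_cpt hdt0 hdt hU
    (x := fun k p => u k (p + 1)) (v := fun k p => eV k (p + 1) (w k (p + 1)))
    (C := (CV ^ 2 + 1) * CA) (M := M) (fun k p hp => huw k (p + 1) (by omega) hp)
    (fun k p hp t ht => hUu k (p + 1) (by omega) hp t (by simpa using ht)) (by positivity)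
    (fun k p hp => huM k (p + 1) (by omega) hp) (fun k => ?_) fun ε hε => ?_
  · exact isCompact_iff_totallyBounded_isComplete.2 ⟨htot.closure, isClosed_closure.isComplete⟩
  · have h1 := hsumA' k
    have h2 : ∑ p ∈ Finset.range (N k), ‖eV k (p + 1) (w k (p + 1))‖ ^ 2 ≤
        (CV ^ 2 + 1) * ∑ p ∈ Finset.range (N k), ‖w k (p + 1)‖ ^ 2 := by
      rw [Finset.mul_sum]
      refine Finset.sum_le_sum fun p hp => ?_
      have h3 := pow_le_pow_left₀ (norm_nonneg _)
        (hCV k (p + 1) (by omega) (by have := Finset.mem_range.1 hp; omega) (w k (p + 1))) 2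
      nlinarith [sq_nonneg ‖w k (p + 1)‖]
    calc _ ≤ ((CV ^ 2 + 1) * ∑ p ∈ Finset.range (N k), ‖w k (p + 1)‖ ^ 2) * dt k :=
          mul_le_mul_of_nonneg_right h2 (hdt0 k).le
      _ = (CV ^ 2 + 1) * ((∑ p ∈ Finset.range (N k), ‖w k (p + 1)‖ ^ 2) * dt k) := mul_assoc _ _ _
      _ ≤ _ := mul_le_mul_of_nonneg_left h1 (by positivity)
  · obtain ⟨D, hD0, h, hh0, hh⟩ := hinc (Real.sqrt (ε / (16 * CA))) (by positivity)
    refine ⟨min h (ε / (4 * (D ^ 2 * T + 1))), lt_min hh0 (by positivity), fun k i hi hih => ?_⟩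
    refine (MovingSpaces.sum_translate_sq_le (x := fun p => u k (p + 1))
      (ω := fun p => ‖w k (p + 1)‖) (η := Real.sqrt (ε / (16 * CA)))
      (E := D * Real.sqrt (i * dt k)) (hdt0 k).le (hdt k) (hsumA' k) fun n hn => ?_).trans ?_
    · have h1 := hh k (n + 1) i hi (by omega) (by omega) (hih.trans (min_le_left _ _))
      rw [add_right_comm] at h1
      exact h1
    · have hidt : 0 ≤ i * dt k := mul_nonneg (Nat.cast_nonneg i) (hdt0 k).le
      rw [Real.sq_sqrt (by positivity), mul_pow, Real.sq_sqrt hidt]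
      have h2 : 8 * (ε / (16 * CA)) * CA = ε / 2 := by
        field_simp
        norm_num
      have h3 := hih.trans (min_le_right _ _)
      rw [le_div_iff₀ (by positivity)] at h3
      rw [h2]
      linarith
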